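/- **Notation.** $\mathbb R^{N\times N}$ carries the Frobenius inner product and norm. For $X\in\mathbb R^{N\times N}$ let $\mathcal S^0(X)=\exp(X)$ entrywise, let $\mathcal S^{k}(X)=\mathcal T_c(\mathcal T_r(\mathcal S^{k-1}(X)))$, where $\mathcal T_r,\mathcal T_c$ divide each entry by its row sum, respectively column sum, and let $\mathcal S(X)=\lim_{k\to\infty}\mathcal S^k(X)$. Let $e_\tau(X)$ be the distance from $\mathcal S(X/\tau)$ to the set of permutation matrices. Call $r\in(0,1)$ a *Sinkhorn rate (with constant $A$)* at $Y$ if $\|\mathcal S^k(Y)-\mathcal S(Y)\|\le A r^k$ for all $k\ge1$. Call $X$ *uniquely matched* if $\langle P,X\rangle$ has exactly one maximiser among the permutation matrices $P$. **PSTE.** Let $f:\mathbb R^{N\times N}\to\mathbb R$ be differentiable with $L$-Lipschitz gradient, $L>0$, and let $\sigma,\tau>0$, $k\ge1$, $T\ge1$. A PSTE run with learning rate $\eta$ consists, for $0\le t\le T$, of random logits $X^t$ (including the Gumbel noise, if any), Gumbel-Sinkhorn matrices $P_{GS}^t=\mathcal S^k(X^t/\tau)$, with $P_{GS}^0$ deterministic,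 matrices $P_{real}^t=\mathrm{Hungarian}(P_{GS}^t)$, i.e. permutation matrices maximising $\langle P,P_{GS}^t\rangle$ over permutation matrices $P$, and square-integrable stochastic gradients $g^t$, such that $P_{GS}^{t+1}=P_{GS}^t-\eta g^t$, $\mathbb E[g^t\mid\mathcal F_t]=\nabla f(P_{real}^t)$ and $\mathbb E\|g^t\|^2\le\sigma^2$, where $(\mathcal F_t)$ is a filtration to which $X^t$ and $P_{real}^t$ are adapted. Let $\eta=c/\sqrt T$ with $c=\sqrt{(f(P_{GS}^0)-f(P_{GS}^\star))/(L\sigma^2)}$, where $P_{GS}^\star$ is a global minimiser of $f$; more generally, any matrix with $f(P_{GS}^\star)\le f(P_{GS}^t)$ almost surely for $0\le t\le T+1$ is allowed, provided that $\nabla f(P_{GS}^0)=0$ in case $f(P_{GS}^0)=f(P_{GS}^\star)$. **Theorem.** Let $N\ge 0$. 1. There is $A>0$ such that for every compact $K\subset\mathbb R^{N\times N}$ there are functions $\tau\mapsto s_\tau$ and $\tau\mapsto r_\tau$ such that, for all $\tau>0$ and all $X\in K$, $e_\tau(X)\le s_\tau$ and $r_\tau\in(0,1)$ is a Sinkhorn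 rate with constant $A$ at $X/\tau$; and if all $X\in K$ are uniquely matched, then $s_\tau\to0$ as $\tau\to0^+$. 2. For every $A>0$ there is $C>0$ (depending only on $A$ and $N$) such that for every PSTE run as above, with $u$ chosen uniformly from $P_{real}^0,\dots,P_{real}^T$, independently of the run, the following holds. (a) If $s$ and $r$ are numbers such that, almost surely, for all $t\le T$, $e_\tau(X^t)\le s$ and $r$ is a Sinkhorn rate with constant $A$ at $X^t/\tau$ (for example $s=s_\tau$, $r=r_\tau$ from part 1 if all $X^t$ lie in $K$), then $$\mathbb E\|\nabla f(u)\|^2\le C\left(\sigma\sqrt{\frac{f(P_{GS}^0)-f(P_{GS}^\star)}{T/L}}+L^2\bigl(s^2+r^{2k}\bigr)\right).$$ (b) If $r_t$ are measurable random numbers such that, almost surely, $r_t$ is a Sinkhorn rate with constant $A$ at $X^t/\tau$ for all $t\le T$, then $$\mathbb E\|\nabla f(u)\|^2\le C\left(\sigma\sqrt{\frac{f(P_{GS}^0)-f(P_{GS}^\star)}{T/L}}+\frac{L^2}{T+1}\sum_{t=0}^T\mathbb E\bigl[e_\tau(X^t)^2+r_t^{2k}\bigr]\right).$$ -/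

import Mathlib

open Filter Topology MeasureTheory

noncomputable section

/-- Real `N × N` matrices with the entrywise `ℓ²` (Frobenius) norm and inner product. -/
abbrev Mat (N : ℕ) : Type := EuclideanSpace ℝ (Fin N × Fin N)

/-- Row-wise normalization. -/
def rowNormalize {N : ℕ} (A : Mat N) : Mat N :=
  WithLp.toLp 2 fun p => A p / ∑ j, A (p.1, j)

/-- Column-wise normalization. -/
def colNormalize {N : ℕ} (A : Mat N) : Mat N :=
  WithLp.toLp 2 fun p => A p / ∑ i, A (i, p.2)

/-- The `k`-th Sinkhorn iterate: entrywise exponential, followed by `k` rounds of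
row normalization and then column normalization. -/
def sinkhornIter {N : ℕ} : ℕ → Mat N → Mat N
  | 0, X => WithLp.toLp 2 fun p => Real.exp (X p)
  | k + 1, X => colNormalize (rowNormalize (sinkhornIter k X))

/-- The Sinkhorn operator, the limit of the Sinkhorn iterates. -/
def sinkhorn {N : ℕ} (X : Mat N) : Mat N :=
  limUnder atTop fun k => sinkhornIter k X

/-- The matrix of a permutation. -/
def permMat {N : ℕ} (π : Equiv.Perm (Fin N)) : Mat N :=
  WithLp.toLp 2 fun p => if π p.1 = p.2 then 1 else 0

/-- `P` is an output of the Hungarian method for the reward matrix `G`: a permutation matrix of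
maximal total reward (any rule may be used to break ties). -/
def IsHungarianOutput {N : ℕ} (G P : Mat N) : Prop :=
  ∃ π : Equiv.Perm (Fin N), P = permMat π ∧
    ∀ π' : Equiv.Perm (Fin N), inner ℝ (permMat π') G ≤ inner ℝ (permMat π) G

/-- The assignment problem with reward matrix `X` has exactly one solution. -/
def HasUniqueAssignment {N : ℕ} (X : Mat N) : Prop :=
  ∃ π : Equiv.Perm (Fin N), ∀ π' : Equiv.Perm (Fin N), π' ≠ π →
    inner ℝ (permMat π') X < inner ℝ (permMat π) X

/-- The temperature error: the distance from the Sinkhorn limit of `X / τ` to the set of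
permutation matrices. -/
def tempError {N : ℕ} (τ : ℝ) (X : Mat N) : ℝ :=
  Metric.infDist (sinkhorn (τ⁻¹ • X)) (Set.range permMat)

/-- `r < 1` is a rate of linear convergence, with constant `A`, of the Sinkhorn iteration
started from `Y`. -/
def IsSinkhornRate {N : ℕ} (A r : ℝ) (Y : Mat N) : Prop :=
  0 < r ∧ r < 1 ∧ ∀ k : ℕ, 1 ≤ k → ‖sinkhornIter k Y - sinkhorn Y‖ ≤ A * r ^ k

/-- `f` is differentiable with `L`-Lipschitz gradient. -/
def IsLSmooth {N : ℕ} (L : ℝ) (f : Mat N → ℝ) : Prop :=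
  Differentiable ℝ f ∧ ∀ P Q : Mat N, ‖gradient f P - gradient f Q‖ ≤ L * ‖P - Q‖

/-- A PSTE run over the steps `0, …, T` with learning rate `η`, Sinkhorn depth `k`, temperature `τ`
and initial matrix `P0`. `X t` is the logit matrix (including the Gumbel noise, if there is any),
`PGS t` the Gumbel-Sinkhorn matrix, `Preal t` its Hungarian permutation matrix and `g t` the
stochastic gradient at `Preal t`, with second moment at most `σ²`, which is passed straight through
to `PGS t`. The `σ`-algebra `ℱ t` is the information before `g t` is drawn. -/
structure IsPSTERun {N : ℕ} {Ω : Type*} [mΩ : MeasurableSpace Ω] (μ : Measure Ω)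
    (ℱ : Filtration ℕ mΩ) (f : Mat N → ℝ) (σ η τ : ℝ) (k T : ℕ) (P0 : Mat N)
    (X PGS Preal g : ℕ → Ω → Mat N) : Prop where
  logit_adapted : ∀ t ≤ T, StronglyMeasurable[ℱ t] (X t)
  real_adapted : ∀ t ≤ T, StronglyMeasurable[ℱ t] (Preal t)
  init : ∀ ω, PGS 0 ω = P0
  gumbel_sinkhorn : ∀ t ≤ T, ∀ ω, PGS t ω = sinkhornIter k (τ⁻¹ • X t ω)
  hungarian : ∀ t ≤ T, ∀ ω, IsHungarianOutput (PGS t ω) (Preal t ω)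
  grad_memLp : ∀ t ≤ T, MemLp (g t) 2 μ
  grad_unbiased : ∀ t ≤ T, μ[g t | ℱ t] =ᵐ[μ] fun ω => gradient f (Preal t ω)
  grad_bound : ∀ t ≤ T, ∫ ω, ‖g t ω‖ ^ 2 ∂μ ≤ σ ^ 2
  update : ∀ t ≤ T, ∀ ω, PGS (t + 1) ω = PGS t ω - η • g t ω

/-- The expectation of `F u ω` over `ω` and over an index `u` that is uniform on `0, …, T` and
independent of `ω`. -/
def uniformExpect {Ω : Type*} [MeasurableSpace Ω] (μ : Measure Ω) (T : ℕ) (F : ℕ → Ω → ℝ) : ℝ :=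
  ∑ t ∈ Finset.range (T + 1), (1 / ((T : ℝ) + 1)) * ∫ ω, F t ω ∂μ

end

/-! Part 1, rate. Row and column scaling preserve the cross ratios `A i j * A k l / (A i l * A k
j)`. For logits bounded by `M` these stay at least `κ = exp (-4M)`, so every normalized iterate has
entries at least `δ = κ / N`. The column sums after a row normalization are weighted averages of the
reciprocal row sums, with weights at least `δ`; such averaging shrinks the relative spread by the
factor `1 - δ`. Hence the row sums tend to `1` geometrically, the steps are summable and the
iteration converges (`exists_geometric_sinkhornIter`). Taking the rate closer to `1` makes the
constant depend on `N` alone (`exists_isSinkhornRate`).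

Part 1, temperature. The logarithm of an iterate is the logit matrix plus a row and a column
potential, and differences of doubly stochastic matrices do not see potentials. So the Sinkhorn
limit loses at most an entropy, bounded by `N ^ 2`, against any permutation in `⟨·, X/τ⟩`. If the
best permutation leads by `γ`, the other permutations have total Birkhoff weight at most `N ^ 2 * τ
/ γ`; compactness makes `γ` uniform.

Part 2. This is biased stochastic gradient descent on `PGS`: the gradient is taken at `Preal`, an
error of at most `L * ‖PGS - Preal‖`. The descent lemma, telescoped over the run, leaves the
optimization term and the mean of `L ^ 2 * ‖PGS - Preal‖ ^ 2`
(`IsPSTERun.uniformExpect_gradient_le`). Since `Preal` is a nearest permutation matrix, that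
distance is at most `tempError + A * r ^ k`. -/

/-! ### Row and column normalization -/

lemma rowNormalize_apply {N : ℕ} (A : Mat N) (i j : Fin N) :
    rowNormalize A (i, j) = A (i, j) / ∑ l, A (i, l) := rfl

lemma colNormalize_apply {N : ℕ} (A : Mat N) (i j : Fin N) :
    colNormalize A (i, j) = A (i, j) / ∑ k, A (k, j) := rfl

lemma norm_le_mul_of_forall_abs_le {N : ℕ} {v : Mat N} {c : ℝ} (hc : 0 ≤ c)
    (h : ∀ i j, |v (i, j)| ≤ c) : ‖v‖ ≤ N * c := by
  rw [EuclideanSpace.norm_eq]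
  apply Real.sqrt_le_iff.2 ⟨by positivity, ?_⟩
  calc ∑ p, ‖v p‖ ^ 2 ≤ ∑ _p : Fin N × Fin N, c ^ 2 := by
        apply Finset.sum_le_sum
        rintro ⟨i, j⟩ -
        exact pow_le_pow_left₀ (norm_nonneg _) (h i j) 2
    _ = (N * c) ^ 2 := by simp; ring

/-- All `2 × 2` cross ratios of `A` are at least `κ`. -/
def CrossRatioBound {N : ℕ} (κ : ℝ) (A : Mat N) : Prop :=
  ∀ i j k l, κ * (A (i, l) * A (k, j)) ≤ A (i, j) * A (k, l)

section Normalize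

variable {N : ℕ} [NeZero N] {A : Mat N} {κ δ h : ℝ}

lemma rowSum_pos (hA : ∀ i j, 0 < A (i, j)) (i : Fin N) : 0 < ∑ j, A (i, j) :=
  Finset.sum_pos (fun j _ => hA i j) Finset.univ_nonempty

lemma colSum_pos (hA : ∀ i j, 0 < A (i, j)) (j : Fin N) : 0 < ∑ i, A (i, j) :=
  Finset.sum_pos (fun i _ => hA i j) Finset.univ_nonempty

lemma rowNormalize_pos (hA : ∀ i j, 0 < A (i, j)) (i j : Fin N) : 0 < rowNormalize A (i, j) :=
  div_pos (hA i j) (rowSum_pos hA i)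

lemma colNormalize_pos (hA : ∀ i j, 0 < A (i, j)) (i j : Fin N) : 0 < colNormalize A (i, j) :=
  div_pos (hA i j) (colSum_pos hA j)

lemma rowSum_rowNormalize (hA : ∀ i j, 0 < A (i, j)) (i : Fin N) :
    ∑ j, rowNormalize A (i, j) = 1 := by
  simp only [rowNormalize_apply, ← Finset.sum_div]
  exact div_self (rowSum_pos hA i).ne'

lemma colSum_colNormalize (hA : ∀ i j, 0 < A (i, j)) (j : Fin N) :
    ∑ i, colNormalize A (i, j) = 1 := by
  simp only [colNormalize_apply, ← Finset.sum_div]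
  exact div_self (colSum_pos hA j).ne'

/-- Both products contain one entry from row `i` and one from row `k`, so the scaling factors agree.
-/
lemma CrossRatioBound.rowNormalize (hA : ∀ i j, 0 < A (i, j)) (hκ : CrossRatioBound κ A) :
    CrossRatioBound κ (rowNormalize A) := by
  intro i j k l
  simp only [rowNormalize_apply]
  rw [div_mul_div_comm, div_mul_div_comm, mul_div_assoc']
  have := mul_pos (rowSum_pos hA i) (rowSum_pos hA k)
  exact div_le_div_of_nonneg_right (hκ i j k l) this.le

lemma CrossRatioBound.colNormalize (hA : ∀ i j, 0 < A (i, j)) (hκ : CrossRatioBound κ A) :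
    CrossRatioBound κ (colNormalize A) := by
  intro i j k l
  simp only [colNormalize_apply]
  rw [div_mul_div_comm, div_mul_div_comm, mul_div_assoc',
    mul_comm (∑ i, A (i, l)) (∑ i, A (i, j))]
  have := mul_pos (colSum_pos hA j) (colSum_pos hA l)
  exact div_le_div_of_nonneg_right (hκ i j k l) this.le

/-- Column normalization of a row-stochastic matrix bounds the entries from below. -/
lemma le_colNormalize (hA : ∀ i j, 0 < A (i, j)) (hκ : CrossRatioBound κ A)
    (hrow : ∀ i, ∑ j, A (i, j) = 1) (i j : Fin N) : κ / N ≤ colNormalize A (i, j) := by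
  have h1 (k : Fin N) : κ * A (k, j) ≤ A (i, j) := by
    have := Finset.sum_le_sum fun l (_ : l ∈ Finset.univ) => hκ i j k l
    rw [← Finset.mul_sum, ← Finset.mul_sum, ← Finset.sum_mul, hrow, hrow] at this
    linarith
  have h2 := Finset.sum_le_sum fun k (_ : k ∈ Finset.univ) => h1 k
  rw [← Finset.mul_sum] at h2
  simp only [Finset.sum_const, Finset.card_univ, Fintype.card_fin, nsmul_eq_mul] at h2
  rw [colNormalize_apply, div_le_div_iff₀ (Nat.cast_pos.2 (NeZero.pos N)) (colSum_pos hA j)]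
  linarith

/-- Row normalization of a column-stochastic matrix bounds the entries from below. -/
lemma le_rowNormalize (hA : ∀ i j, 0 < A (i, j)) (hκ : CrossRatioBound κ A)
    (hcol : ∀ j, ∑ i, A (i, j) = 1) (i j : Fin N) : κ / N ≤ rowNormalize A (i, j) := by
  have h1 (l : Fin N) : κ * A (i, l) ≤ A (i, j) := by
    have := Finset.sum_le_sum fun k (_ : k ∈ Finset.univ) => hκ i j k l
    rw [← Finset.mul_sum, ← Finset.mul_sum, ← Finset.mul_sum, hcol, hcol] at this
    linarith
  have h2 := Finset.sum_le_sum fun k (_ : k ∈ Finset.univ) => h1 k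
  rw [← Finset.mul_sum] at h2
  simp only [Finset.sum_const, Finset.card_univ, Fintype.card_fin, nsmul_eq_mul] at h2
  rw [rowNormalize_apply, div_le_div_iff₀ (Nat.cast_pos.2 (NeZero.pos N)) (rowSum_pos hA i)]
  linarith

/-- Averaging with weights at least `δ` contracts the relative spread by `1 - δ`. -/
lemma sum_mul_le_of_spread {ι : Type*} [Fintype ι] [Nonempty ι] {w w' y : ι → ℝ}
    (hh : 0 ≤ h) (hδ : 0 ≤ δ) (hw : ∀ i, δ ≤ w i) (hw' : ∀ i, 0 ≤ w' i) (sw : ∑ i, w i = 1)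
    (sw' : ∑ i, w' i = 1) (hy : ∀ i, 0 < y i) (hyy : ∀ i k, y i ≤ (1 + h) * y k) :
    ∑ i, w i * y i ≤ (1 + (1 - δ) * h) * ∑ i, w' i * y i := by
  classical
  obtain ⟨i₀, hi₀⟩ := Finite.exists_min y
  have hδ1 : δ ≤ 1 := (hw i₀).trans <| sw ▸
    Finset.single_le_sum (fun i _ => hδ.trans (hw i)) (Finset.mem_univ i₀)
  have h1 : y i₀ ≤ ∑ i, w' i * y i := by
    calc y i₀ = ∑ i, w' i * y i₀ := by rw [← Finset.sum_mul, sw', one_mul]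
      _ ≤ _ := Finset.sum_le_sum fun i _ => mul_le_mul_of_nonneg_left (hi₀ i) (hw' i)
  -- The minimizer `i₀` carries weight at least `δ` and contributes `y i₀` instead of `(1 + h) * y
  -- i₀`; this saves `δ * h * y i₀`.
  have h2 : ∑ i, w i * y i ≤ (1 + (1 - δ) * h) * y i₀ := by
    calc ∑ i, w i * y i
        ≤ ∑ i, (w i * ((1 + h) * y i₀) - if i = i₀ then w i₀ * (h * y i₀) else 0) := by
          apply Finset.sum_le_sum
          intro i _
          split_ifs with hi
          · subst hi
            exact le_of_eq (by ring)
          · simpa using mul_le_mul_of_nonneg_left (hyy i i₀) (hδ.trans (hw i))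
      _ = (1 + h) * y i₀ - w i₀ * (h * y i₀) := by
          rw [Finset.sum_sub_distrib, ← Finset.sum_mul, sw, one_mul]
          simp
      _ ≤ (1 + (1 - δ) * h) * y i₀ := by
          have := mul_le_mul_of_nonneg_right (hw i₀) (mul_nonneg hh (hy i₀).le)
          linarith
  refine h2.trans (mul_le_mul_of_nonneg_left h1 ?_)
  have := mul_nonneg (sub_nonneg.2 hδ1) hh
  linarith

lemma inv_le_of_le {a b c : ℝ} (ha : 0 < a) (hb : 0 < b) (h : a ≤ c * b) : b⁻¹ ≤ c * a⁻¹ := by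
  rw [← div_eq_mul_inv, le_div_iff₀ ha, inv_mul_le_iff₀ hb]
  linarith

/-- Column sum `j` is the average of the reciprocal row sums with weights `A (i, j)`, which add up
to `1`; reciprocals have the same relative spread as the row sums. -/
lemma colSum_rowNormalize_spread (hδ : 0 < δ) (hA : ∀ i j, δ ≤ A (i, j))
    (hcol : ∀ j, ∑ i, A (i, j) = 1) (hh : 0 ≤ h)
    (hs : ∀ i k, ∑ j, A (i, j) ≤ (1 + h) * ∑ j, A (k, j)) (j l : Fin N) :
    ∑ i, rowNormalize A (i, j) ≤ (1 + (1 - δ) * h) * ∑ i, rowNormalize A (i, l) := by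
  have hA0 : ∀ i j, 0 < A (i, j) := fun i j => hδ.trans_le (hA i j)
  simp only [rowNormalize_apply, div_eq_mul_inv]
  exact sum_mul_le_of_spread hh hδ.le (hA · j) (fun i => (hA0 i l).le) (hcol j) (hcol l)
    (fun i => inv_pos.2 (rowSum_pos hA0 i))
    fun i k => inv_le_of_le (rowSum_pos hA0 k) (rowSum_pos hA0 i) (hs k i)

lemma rowSum_colNormalize_spread (hδ : 0 < δ) (hA : ∀ i j, δ ≤ A (i, j))
    (hrow : ∀ i, ∑ j, A (i, j) = 1) (hh : 0 ≤ h)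
    (hs : ∀ j l, ∑ i, A (i, j) ≤ (1 + h) * ∑ i, A (i, l)) (i k : Fin N) :
    ∑ j, colNormalize A (i, j) ≤ (1 + (1 - δ) * h) * ∑ j, colNormalize A (k, j) := by
  have hA0 : ∀ i j, 0 < A (i, j) := fun i j => hδ.trans_le (hA i j)
  simp only [colNormalize_apply, div_eq_mul_inv]
  exact sum_mul_le_of_spread hh hδ.le (hA i ·) (fun j => (hA0 k j).le) (hrow i) (hrow k)
    (fun j => inv_pos.2 (colSum_pos hA0 j))
    fun j l => inv_le_of_le (colSum_pos hA0 l) (colSum_pos hA0 j) (hs l j)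

/-- Positive numbers with mean `1` and relative spread `h` lie in `[(1 + h)⁻¹, 1 + h]`. -/
lemma le_and_le_of_spread {y : Fin N → ℝ} (sy : ∑ i, y i = N)
    (hyy : ∀ i k, y i ≤ (1 + h) * y k) (i : Fin N) : y i ≤ 1 + h ∧ 1 ≤ (1 + h) * y i := by
  have hN : (0 : ℝ) < N := Nat.cast_pos.2 (NeZero.pos N)
  have h1 := Finset.sum_le_sum fun k (_ : k ∈ Finset.univ) => hyy i k
  have h2 := Finset.sum_le_sum fun k (_ : k ∈ Finset.univ) => hyy k i
  rw [← Finset.mul_sum, sy] at h1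
  rw [sy] at h2
  simp only [Finset.sum_const, Finset.card_univ, Fintype.card_fin, nsmul_eq_mul] at h1 h2
  constructor
  · exact le_of_mul_le_mul_left (by linarith) hN
  · exact le_of_mul_le_mul_left (by linarith) hN

/-- One round of Sinkhorn moves a column-stochastic matrix at most by a multiple of the spread of
its row sums. -/
lemma abs_sinkhornStep_sub_le (hδ : 0 < δ) (hA : ∀ i j, δ ≤ A (i, j))
    (hcol : ∀ j, ∑ i, A (i, j) = 1) (hh : 0 ≤ h)
    (hs : ∀ i k, ∑ j, A (i, j) ≤ (1 + h) * ∑ j, A (k, j)) (i j : Fin N) :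
    |colNormalize (rowNormalize A) (i, j) - A (i, j)| ≤ (2 + h) * h := by
  have hA0 : ∀ i j, 0 < A (i, j) := fun i j => hδ.trans_le (hA i j)
  have hB0 := rowNormalize_pos hA0
  have hr := le_and_le_of_spread (y := fun i => ∑ j, A (i, j))
    (by rw [Finset.sum_comm]; simp [hcol]) hs i
  have hδ1 : δ ≤ 1 := (hA i j).trans <| hcol j ▸
    Finset.single_le_sum (fun i _ => (hA0 i j).le) (Finset.mem_univ i)
  have hc := le_and_le_of_spread (h := h) (y := fun j => ∑ i, rowNormalize A (i, j))
    (by rw [Finset.sum_comm]; simp [rowSum_rowNormalize hA0])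
    (fun j l => (colSum_rowNormalize_spread hδ hA hcol hh hs j l).trans (by
      have := (colSum_pos hB0 l).le
      gcongr
      linarith [mul_nonneg hδ.le hh])) j
  set B := rowNormalize A with hB
  have hle : colNormalize B (i, j) ≤ 1 := (colSum_colNormalize hB0 j) ▸
    Finset.single_le_sum (f := fun i => colNormalize B (i, j))
      (fun i _ => (colNormalize_pos hB0 i j).le) (Finset.mem_univ i)
  have h0 := colNormalize_pos hB0 i j
  have hρ := rowSum_pos hA0 i
  have hγ := colSum_pos hB0 j
  -- The round divides the entry by its row sum `ρ` and then by the new column sum `γ`. Both lie in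
  -- `[(1 + h)⁻¹, 1 + h]`, and `(1 + h) ^ 2 - 1 = (2 + h) * h`.
  have e : A (i, j) = colNormalize B (i, j) * ((∑ j, A (i, j)) * ∑ i, B (i, j)) := by
    rw [colNormalize_apply, hB, rowNormalize_apply, ← hB]
    field_simp
  generalize (∑ j, A (i, j)) = ρ at *
  generalize (∑ i, B (i, j)) = γ at *
  generalize colNormalize B (i, j) = x at *
  rw [e, show x - x * (ρ * γ) = x * (1 - ρ * γ) by ring, abs_mul, abs_of_pos h0]
  have h3 : |1 - ρ * γ| ≤ (2 + h) * h := by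
    obtain ⟨r1, r2⟩ := hr
    obtain ⟨c1, c2⟩ := hc
    have u : ρ * γ ≤ (1 + h) * (1 + h) := mul_le_mul r1 c1 hγ.le (by linarith)
    have l : 1 * 1 ≤ ((1 + h) * ρ) * ((1 + h) * γ) := mul_le_mul r2 c2 zero_le_one (by positivity)
    rw [abs_le]
    constructor
    · nlinarith
    · have hp : 0 < ρ * γ := mul_pos hρ hγ
      by_contra! hcon
      nlinarith [sq_nonneg h, mul_nonneg hh (sq_nonneg h),
        mul_pos hp (show 0 < (1 + h) ^ 2 by positivity)]
  calc x * |1 - ρ * γ| ≤ 1 * |1 - ρ * γ| := by gcongr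
    _ ≤ _ := by rw [one_mul]; exact h3

end Normalize

/-! ### Convergence of the Sinkhorn iteration -/

lemma sinkhornIter_zero_apply {N : ℕ} (Y : Mat N) (p : Fin N × Fin N) :
    sinkhornIter 0 Y p = Real.exp (Y p) := rfl

lemma sinkhornIter_succ {N : ℕ} (k : ℕ) (Y : Mat N) :
    sinkhornIter (k + 1) Y = colNormalize (rowNormalize (sinkhornIter k Y)) := rfl

section Iter

variable {N : ℕ} [NeZero N]

lemma sinkhornIter_pos (k : ℕ) (Y : Mat N) (i j : Fin N) : 0 < sinkhornIter k Y (i, j) := by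
  induction k generalizing i j with
  | zero => exact Real.exp_pos _
  | succ k ih => exact colNormalize_pos (rowNormalize_pos ih) i j

lemma colSum_sinkhornIter (k : ℕ) (Y : Mat N) (j : Fin N) :
    ∑ i, sinkhornIter (k + 1) Y (i, j) = 1 :=
  colSum_colNormalize (rowNormalize_pos (sinkhornIter_pos k Y)) j

lemma sinkhornIter_le_one (k : ℕ) (Y : Mat N) (i j : Fin N) :
    sinkhornIter (k + 1) Y (i, j) ≤ 1 :=
  colSum_sinkhornIter k Y j ▸ Finset.single_le_sum
    (f := fun i => sinkhornIter (k + 1) Y (i, j))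
    (fun i _ => (sinkhornIter_pos _ Y i j).le) (Finset.mem_univ i)

lemma crossRatioBound_sinkhornIter {M : ℝ} {Y : Mat N} (hY : ∀ p, |Y p| ≤ M) (k : ℕ) :
    CrossRatioBound (Real.exp (-(4 * M))) (sinkhornIter k Y) := by
  induction k with
  | zero =>
    intro i j k l
    simp only [sinkhornIter_zero_apply, ← Real.exp_add]
    apply Real.exp_le_exp.2
    have h1 := abs_le.1 (hY (i, j))
    have h2 := abs_le.1 (hY (i, l))
    have h3 := abs_le.1 (hY (k, j))
    have h4 := abs_le.1 (hY (k, l))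
    linarith [h1.1, h2.2, h3.2, h4.1]
  | succ k ih =>
    have hp := sinkhornIter_pos k Y
    exact (ih.rowNormalize hp).colNormalize (rowNormalize_pos hp)

lemma le_sinkhornIter {M : ℝ} {Y : Mat N} (hY : ∀ p, |Y p| ≤ M) (k : ℕ) (i j : Fin N) :
    Real.exp (-(4 * M)) / N ≤ sinkhornIter (k + 1) Y (i, j) :=
  have hp := sinkhornIter_pos k Y
  le_colNormalize (rowNormalize_pos hp) ((crossRatioBound_sinkhornIter hY k).rowNormalize hp)
    (rowSum_rowNormalize hp) i j

lemma rowSum_sinkhornIter_spread {M : ℝ} {Y : Mat N} (hY : ∀ p, |Y p| ≤ M) (k : ℕ)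
    (i l : Fin N) :
    ∑ j, sinkhornIter (k + 1) Y (i, j) ≤
      (1 + N / Real.exp (-(4 * M)) * (1 - Real.exp (-(4 * M)) / N) ^ k) *
        ∑ j, sinkhornIter (k + 1) Y (l, j) := by
  have hN : (0 : ℝ) < N := Nat.cast_pos.2 (NeZero.pos N)
  have hκ := Real.exp_pos (-(4 * M))
  set κ := Real.exp (-(4 * M))
  have hδ : 0 < κ / N := by positivity
  have hδ1 : κ / N ≤ 1 := (le_sinkhornIter hY 0 i i).trans (sinkhornIter_le_one 0 Y i i)
  induction k generalizing i l with
  | zero =>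
    -- After one round the row sums lie between `N * (κ / N) = κ` and `N`, whence the initial spread
    -- `N / κ`.
    have h1 : ∑ j, sinkhornIter (0 + 1) Y (i, j) ≤ N := by
      simpa using Finset.sum_le_sum fun j (_ : j ∈ Finset.univ) => sinkhornIter_le_one 0 Y i j
    have h2 : κ ≤ ∑ j, sinkhornIter (0 + 1) Y (l, j) := by
      have := Finset.sum_le_sum fun j (_ : j ∈ Finset.univ) => le_sinkhornIter hY 0 l j
      simp only [Finset.sum_const, Finset.card_univ, Fintype.card_fin, nsmul_eq_mul] at this
      rwa [mul_div_cancel₀ _ hN.ne'] at this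
    calc _ ≤ (N : ℝ) := h1
      _ = N / κ * κ := by field_simp
      _ ≤ (1 + N / κ * (1 - κ / N) ^ 0) * κ := by rw [pow_zero, mul_one]; gcongr; linarith
      _ ≤ _ := by gcongr
  | succ k ih =>
    have hA0 := sinkhornIter_pos (k + 1) Y
    have hA := le_sinkhornIter hY k
    have hB := le_rowNormalize hA0 (crossRatioBound_sinkhornIter hY (k + 1))
      (colSum_sinkhornIter k Y)
    have hq : 0 ≤ 1 - κ / N := by linarith
    have hh : 0 ≤ N / κ * (1 - κ / N) ^ k := by positivity
    have hc := colSum_rowNormalize_spread hδ hA (colSum_sinkhornIter k Y) hh ih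
    have hr := rowSum_colNormalize_spread hδ hB (rowSum_rowNormalize hA0)
      (mul_nonneg hq hh) hc i l
    refine hr.trans ?_
    have := (rowSum_pos (sinkhornIter_pos (k + 1 + 1) Y) l).le
    refine mul_le_mul_of_nonneg_right ?_ this
    -- Each half-round contracts by `1 - κ / N`; only one of the two factors is kept, the other is
    -- bounded by `1`.
    have e : N / κ * (1 - κ / N) ^ (k + 1) = 1 * ((1 - κ / N) * (N / κ * (1 - κ / N) ^ k)) := by
      ring
    rw [e]
    gcongr
    linarith

end Iter

/-- Sinkhorn's iteration converges, with a linear rate that is uniform over bounded sets. -/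
lemma exists_geometric_sinkhornIter (N : ℕ) (M : ℝ) : ∃ B q : ℝ, 0 ≤ B ∧ 0 ≤ q ∧ q < 1 ∧
    ∀ Y : Mat N, (∀ p, |Y p| ≤ M) → Tendsto (sinkhornIter · Y) atTop (𝓝 (sinkhorn Y)) ∧
      ∀ k, ‖sinkhornIter (k + 1) Y - sinkhorn Y‖ ≤ B * q ^ k := by
  rcases Nat.eq_zero_or_pos N with rfl | hN
  · refine ⟨0, 0, le_rfl, le_rfl, one_pos, fun Y _ => ⟨?_, fun k => ?_⟩⟩
    · rw [show (sinkhornIter · Y) = fun _ => sinkhorn Y from funext fun _ => Subsingleton.elim _ _]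
      exact tendsto_const_nhds
    · rw [Subsingleton.elim (sinkhornIter (k + 1) Y) (sinkhorn Y)]
      simp
  have : NeZero N := ⟨hN.ne'⟩
  have hN : (0 : ℝ) < N := Nat.cast_pos.2 hN
  -- For negative `M` the claim is vacuous. Otherwise some admissible `Y` exists, and its entries
  -- witness `κ / N ≤ 1`.
  by_cases hY0 : ∃ Y : Mat N, ∀ p, |Y p| ≤ M
  swap
  · exact ⟨0, 0, le_rfl, le_rfl, one_pos, fun Y hY => (hY0 ⟨Y, hY⟩).elim⟩
  have hκ := Real.exp_pos (-(4 * M))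
  have hδ1 : Real.exp (-(4 * M)) / N ≤ 1 := by
    obtain ⟨Y, hY⟩ := hY0
    exact (le_sinkhornIter hY 0 0 0).trans (sinkhornIter_le_one 0 Y 0 0)
  set κ := Real.exp (-(4 * M)) with hκdef
  have hδ : 0 < κ / N := by positivity
  set q := 1 - κ / N with hq
  have hq0 : 0 ≤ q := by linarith
  have hq1 : q < 1 := by linarith
  have hC : 0 ≤ N * ((2 + N / κ) * (N / κ)) := by positivity
  refine ⟨N * ((2 + N / κ) * (N / κ)) / (1 - q), q, div_nonneg hC (by linarith), hq0, hq1,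
    fun Y hY => ?_⟩
  have hstep (k : ℕ) : dist (sinkhornIter (k + 1) Y) (sinkhornIter (k + 1 + 1) Y) ≤
      N * ((2 + N / κ) * (N / κ)) * q ^ k := by
    have hh : 0 ≤ N / κ * q ^ k := by positivity
    have hle : N / κ * q ^ k ≤ N / κ :=
      mul_le_of_le_one_right (by positivity) (pow_le_one₀ hq0 hq1.le)
    rw [dist_comm, dist_eq_norm, mul_assoc]
    apply norm_le_mul_of_forall_abs_le (by positivity)
    intro i j
    refine (abs_sinkhornStep_sub_le hδ (le_sinkhornIter hY k) (colSum_sinkhornIter k Y) hh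
      (rowSum_sinkhornIter_spread hY k) i j).trans ?_
    rw [mul_assoc]
    gcongr
  have hlim : Tendsto (sinkhornIter · Y) atTop (𝓝 (sinkhorn Y)) := by
    obtain ⟨a, ha⟩ := cauchySeq_tendsto_of_complete (cauchySeq_of_le_geometric _ _ hq1 hstep)
    have ha' : Tendsto (sinkhornIter · Y) atTop (𝓝 a) := (tendsto_add_atTop_iff_nat 1).1 ha
    rwa [show sinkhorn Y = a from ha'.limUnder_eq]
  refine ⟨hlim, fun k => ?_⟩
  have := dist_le_of_le_geometric_of_tendsto _ _ hq1 hstep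
    ((tendsto_add_atTop_iff_nat 1).2 hlim) k
  rw [dist_eq_norm] at this
  exact this.trans (le_of_eq (by ring))

/-! ### Double stochasticity of the Sinkhorn limit -/

lemma abs_apply_le_norm {N : ℕ} (Y : Mat N) (p : Fin N × Fin N) : |Y p| ≤ ‖Y‖ :=
  PiLp.norm_apply_le Y p

lemma tendsto_sinkhornIter {N : ℕ} (Y : Mat N) :
    Tendsto (sinkhornIter · Y) atTop (𝓝 (sinkhorn Y)) := by
  obtain ⟨_, _, _, _, _, h⟩ := exists_geometric_sinkhornIter N ‖Y‖
  exact (h Y (abs_apply_le_norm Y)).1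

lemma tendsto_sinkhornIter_apply {N : ℕ} (Y : Mat N) (p : Fin N × Fin N) :
    Tendsto (fun k => sinkhornIter (k + 1) Y p) atTop (𝓝 (sinkhorn Y p)) :=
  ((EuclideanSpace.proj (𝕜 := ℝ) p).continuous.tendsto _).comp
    ((tendsto_add_atTop_iff_nat 1).2 (tendsto_sinkhornIter Y))

lemma neZero_of_fin {N : ℕ} (i : Fin N) : NeZero N := ⟨by rintro rfl; exact i.elim0⟩

/-- The lower bound `κ / N` is uniform in the iterate, so it survives the limit; this keeps the
logarithms below finite. -/
lemma sinkhorn_pos {N : ℕ} (Y : Mat N) (p : Fin N × Fin N) : 0 < sinkhorn Y p := by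
  have := neZero_of_fin p.1
  have hN : (0 : ℝ) < N := Nat.cast_pos.2 (NeZero.pos N)
  refine lt_of_lt_of_le (by positivity : 0 < Real.exp (-(4 * ‖Y‖)) / N) ?_
  exact ge_of_tendsto' (tendsto_sinkhornIter_apply Y p)
    fun k => le_sinkhornIter (abs_apply_le_norm Y) k p.1 p.2

lemma sinkhorn_le_one {N : ℕ} (Y : Mat N) (p : Fin N × Fin N) : sinkhorn Y p ≤ 1 := by
  have := neZero_of_fin p.1
  exact le_of_tendsto' (tendsto_sinkhornIter_apply Y p) fun k => sinkhornIter_le_one k Y p.1 p.2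

lemma colSum_sinkhorn {N : ℕ} (Y : Mat N) (j : Fin N) : ∑ i, sinkhorn Y (i, j) = 1 := by
  have := neZero_of_fin j
  have h := tendsto_finsetSum Finset.univ
    fun i (_ : i ∈ Finset.univ) => tendsto_sinkhornIter_apply Y (i, j)
  simp only [colSum_sinkhornIter] at h
  exact tendsto_nhds_unique h tendsto_const_nhds

/-- Column sums are exactly `1` after every round, row sums only in the limit: they have mean `1`
and their spread tends to `0`. -/
lemma rowSum_sinkhorn {N : ℕ} (Y : Mat N) (i : Fin N) : ∑ j, sinkhorn Y (i, j) = 1 := by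
  have := neZero_of_fin i
  have hN : (0 : ℝ) < N := Nat.cast_pos.2 (NeZero.pos N)
  have hY := abs_apply_le_norm Y
  set κ := Real.exp (-(4 * ‖Y‖)) with hκdef
  have hκ : 0 < κ := Real.exp_pos _
  have hδ1 : κ / N ≤ 1 := (le_sinkhornIter hY 0 i i).trans (sinkhornIter_le_one 0 Y i i)
  have hδ : 0 < κ / N := by positivity
  set h : ℕ → ℝ := fun k => 1 + N / κ * (1 - κ / N) ^ k with hdef
  have hlim : Tendsto h atTop (𝓝 1) := by
    simpa using ((tendsto_pow_atTop_nhds_zero_of_lt_one (by linarith : 0 ≤ 1 - κ / N)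
      (by linarith)).const_mul (N / κ)).const_add 1
  have hs := tendsto_finsetSum Finset.univ
    fun j (_ : j ∈ Finset.univ) => tendsto_sinkhornIter_apply Y (i, j)
  have hb (k : ℕ) := le_and_le_of_spread (y := fun i => ∑ j, sinkhornIter (k + 1) Y (i, j))
    (by rw [Finset.sum_comm]; simp [colSum_sinkhornIter]) (rowSum_sinkhornIter_spread hY k) i
  apply le_antisymm
  · exact le_of_tendsto_of_tendsto' hs hlim fun k => (hb k).1
  · have := le_of_tendsto_of_tendsto' tendsto_const_nhds (hlim.mul hs) fun k => (hb k).2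
    rwa [one_mul] at this

lemma abs_sub_le_one {a b : ℝ} (ha : 0 ≤ a) (ha1 : a ≤ 1) (hb : 0 ≤ b) (hb1 : b ≤ 1) :
    |a - b| ≤ 1 := by
  rw [abs_le]; constructor <;> linarith

/-- The geometric rate can be absorbed into `r`, so that the constant depends only on `N`. -/
lemma exists_isSinkhornRate (N : ℕ) (M : ℝ) : ∃ r : ℝ, ∀ Y : Mat N, (∀ p, |Y p| ≤ M) →
    IsSinkhornRate (2 * N + 2) r Y := by
  obtain ⟨B, q, hB, hq0, hq1, h⟩ := exists_geometric_sinkhornIter N M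
  set ρ := (1 + q) / 2 with hρ
  have hρ0 : 0 < ρ := by linarith
  have hlim : Tendsto (fun k => B * (q / ρ) ^ k) atTop (𝓝 0) := by
    simpa using (tendsto_pow_atTop_nhds_zero_of_lt_one (div_nonneg hq0 hρ0.le)
      ((div_lt_one hρ0).2 (by linarith))).const_mul B
  obtain ⟨k₀, hk₀⟩ := eventually_atTop.1 (hlim.eventually (ge_mem_nhds one_pos))
  have hpow : Tendsto (fun r : ℝ => r ^ k₀) (𝓝[<] 1) (𝓝 1) := by
    have : Tendsto (fun r : ℝ => r ^ k₀) (𝓝 1) (𝓝 (1 ^ k₀)) := (continuous_pow k₀).tendsto 1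
    rw [one_pow] at this
    exact this.mono_left nhdsWithin_le_nhds
  have hid : Tendsto (fun r : ℝ => r) (𝓝[<] 1) (𝓝 1) := nhdsWithin_le_nhds
  -- Take `r < 1` so close to `1` that `r ^ k₀ ≥ 1 / 2`, `r ≥ ρ` and `r ≥ 1 / 2`. The trivial bound
  -- `N` then serves the iterates up to `k₀`, and `B * q ^ k ≤ ρ ^ k` the later ones.
  obtain ⟨r, ⟨⟨h1, h2⟩, h3⟩, h4⟩ :=
    (((hpow.eventually (le_mem_nhds (by norm_num : (1 / 2 : ℝ) < 1))).and
    (hid.eventually (le_mem_nhds (by linarith : ρ < 1)))).and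
    (hid.eventually (le_mem_nhds (by norm_num : (1 / 2 : ℝ) < 1)))).and
    self_mem_nhdsWithin |>.exists
  have h4 : r < 1 := h4
  have hr0 : 0 < r := by linarith
  refine ⟨r, fun Y hY => ⟨hr0, h4, fun k hk => ?_⟩⟩
  obtain ⟨k, rfl⟩ := Nat.exists_eq_add_of_le' hk
  rcases lt_or_ge k k₀ with hlt | hge
  · have hN : ‖sinkhornIter (k + 1) Y - sinkhorn Y‖ ≤ N * 1 := by
      apply norm_le_mul_of_forall_abs_le zero_le_one
      intro i j
      have := neZero_of_fin i
      rw [PiLp.sub_apply]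
      exact abs_sub_le_one (sinkhornIter_pos _ Y i j).le (sinkhornIter_le_one k Y i j)
        (sinkhorn_pos Y _).le (sinkhorn_le_one Y _)
    have : (1 / 2 : ℝ) ≤ r ^ (k + 1) := h1.trans (pow_le_pow_of_le_one hr0.le h4.le hlt)
    nlinarith [(Nat.cast_nonneg N : (0 : ℝ) ≤ N)]
  · have e1 : B * q ^ k ≤ ρ ^ k := by
      have := hk₀ k hge
      rwa [div_pow, mul_div_assoc', div_le_one (by positivity)] at this
    have e2 : ρ ^ k ≤ r ^ k := pow_le_pow_left₀ hρ0.le h2 k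
    have e3 : 0 < r ^ k := by positivity
    calc _ ≤ B * q ^ k := (h Y hY).2 k
      _ ≤ r ^ k := e1.trans e2
      _ ≤ (2 * N + 2) * r ^ (k + 1) := by
        rw [pow_succ]
        have : 1 ≤ (2 * (N : ℝ) + 2) * r := by nlinarith [(Nat.cast_nonneg N : (0 : ℝ) ≤ N)]
        nlinarith

/-! ### The zero-temperature limit -/

lemma permMat_apply {N : ℕ} (π : Equiv.Perm (Fin N)) (i j : Fin N) :
    permMat π (i, j) = if π i = j then 1 else 0 := rfl

lemma inner_eq_sum {N : ℕ} (P Q : Mat N) : inner ℝ P Q = ∑ i, ∑ j, P (i, j) * Q (i, j) := by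
  rw [PiLp.inner_apply, Fintype.sum_prod_type]
  simp [mul_comm]

/-- Sinkhorn scaling changes the log-entries by a row and a column potential. -/
lemma exists_log_sinkhornIter {N : ℕ} (Y : Mat N) (k : ℕ) : ∃ a b : Fin N → ℝ, ∀ i j,
    Real.log (sinkhornIter k Y (i, j)) = Y (i, j) + a i + b j := by
  induction k with
  | zero => exact ⟨0, 0, fun i j => by simp [sinkhornIter_zero_apply]⟩
  | succ k ih =>
    obtain ⟨a, b, h⟩ := ih
    refine ⟨fun i => a i - Real.log (∑ l, sinkhornIter k Y (i, l)),
      fun j => b j - Real.log (∑ l, rowNormalize (sinkhornIter k Y) (l, j)), fun i j => ?_⟩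
    have := neZero_of_fin i
    have hp := sinkhornIter_pos k Y
    rw [sinkhornIter_succ, colNormalize_apply,
      Real.log_div (rowNormalize_pos hp i j).ne' (colSum_pos (rowNormalize_pos hp) j).ne',
      rowNormalize_apply, Real.log_div (hp i j).ne' (rowSum_pos hp i).ne', h]
    ring

/-- The logarithm of the Sinkhorn limit and the logits have the same pairing with differences of
doubly stochastic matrices. -/
lemma sum_mul_log_sinkhorn {N : ℕ} (Y : Mat N) {D : Fin N → Fin N → ℝ}
    (hr : ∀ i, ∑ j, D i j = 0) (hc : ∀ j, ∑ i, D i j = 0) :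
    ∑ i, ∑ j, D i j * Real.log (sinkhorn Y (i, j)) = ∑ i, ∑ j, D i j * Y (i, j) := by
  -- The potentials depend on `k` and need not be shown to converge: they cancel before the limit is
  -- taken.
  have hk (k : ℕ) : ∑ i, ∑ j, D i j * Real.log (sinkhornIter (k + 1) Y (i, j)) =
      ∑ i, ∑ j, D i j * Y (i, j) := by
    obtain ⟨a, b, h⟩ := exists_log_sinkhornIter Y (k + 1)
    simp only [h, mul_add, Finset.sum_add_distrib]
    have e1 : ∑ i, ∑ j, D i j * a i = 0 := by simp [← Finset.sum_mul, hr]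
    have e2 : ∑ i, ∑ j, D i j * b j = 0 := by
      rw [Finset.sum_comm]
      simp [← Finset.sum_mul, hc]
    rw [e1, e2, add_zero, add_zero]
  have hlim : Tendsto (fun k => ∑ i, ∑ j, D i j * Real.log (sinkhornIter (k + 1) Y (i, j))) atTop
      (𝓝 (∑ i, ∑ j, D i j * Real.log (sinkhorn Y (i, j)))) :=
    tendsto_finsetSum _ fun i _ => tendsto_finsetSum _ fun j _ =>
      ((tendsto_sinkhornIter_apply Y (i, j)).log (sinkhorn_pos Y _).ne').const_mul _
  simp only [hk] at hlim
  exact tendsto_nhds_unique hlim tendsto_const_nhds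

lemma rowSum_permMat {N : ℕ} (π : Equiv.Perm (Fin N)) (i : Fin N) :
    ∑ j, permMat π (i, j) = 1 := by simp [permMat_apply]

lemma colSum_permMat {N : ℕ} (π : Equiv.Perm (Fin N)) (j : Fin N) :
    ∑ i, permMat π (i, j) = 1 := by
  simp only [permMat_apply, ← Equiv.eq_symm_apply]
  simp

/-- The Sinkhorn limit is nearly optimal for the assignment problem. -/
lemma inner_permMat_sub_sinkhorn_le {N : ℕ} (Y : Mat N) (π : Equiv.Perm (Fin N)) :
    inner ℝ (permMat π) Y - inner ℝ (sinkhorn Y) Y ≤ (N : ℝ) ^ 2 := by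
  have key := sum_mul_log_sinkhorn Y
    (D := fun i j => permMat π (i, j) - sinkhorn Y (i, j))
    (fun i => by simp [Finset.sum_sub_distrib, rowSum_permMat, rowSum_sinkhorn])
    (fun j => by simp [Finset.sum_sub_distrib, colSum_permMat, colSum_sinkhorn])
  have e : inner ℝ (permMat π) Y - inner ℝ (sinkhorn Y) Y =
      ∑ i, ∑ j, (permMat π (i, j) - sinkhorn Y (i, j)) * Y (i, j) := by
    simp only [inner_eq_sum, sub_mul, Finset.sum_sub_distrib]
  rw [e, ← key]
  -- With `s` an entry of the limit, `P * log s ≤ 0` and `-s * log s ≤ 1 - s ≤ 1`, so each entry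
  -- contributes at most `1`.
  calc _ ≤ ∑ _i : Fin N, ∑ _j : Fin N, (1 : ℝ) := by
        refine Finset.sum_le_sum fun i _ => Finset.sum_le_sum fun j _ => ?_
        have h0 := sinkhorn_pos Y (i, j)
        have h1 := sinkhorn_le_one Y (i, j)
        have hlog : Real.log (sinkhorn Y (i, j)) ≤ 0 := Real.log_nonpos h0.le h1
        have hP : 0 ≤ permMat π (i, j) := by rw [permMat_apply]; split_ifs <;> norm_num
        have h2 := Real.one_sub_inv_le_log_of_pos h0
        have h3 : sinkhorn Y (i, j) - 1 ≤ sinkhorn Y (i, j) * Real.log (sinkhorn Y (i, j)) := by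
          have := mul_le_mul_of_nonneg_left h2 h0.le
          rwa [mul_sub, mul_one, mul_inv_cancel₀ h0.ne'] at this
        nlinarith [mul_nonpos_of_nonneg_of_nonpos hP hlog]
    _ = (N : ℝ) ^ 2 := by simp; ring

/-- **Birkhoff's theorem** for the Sinkhorn limit. -/
lemma exists_sinkhorn_eq_sum_permMat {N : ℕ} (Y : Mat N) : ∃ w : Equiv.Perm (Fin N) → ℝ,
    (∀ π, 0 ≤ w π) ∧ ∑ π, w π = 1 ∧ ∑ π, w π • permMat π = sinkhorn Y := by
  obtain ⟨w, h0, h1, h⟩ := exists_eq_sum_perm_of_mem_doublyStochastic (R := ℝ)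
    (M := Matrix.of fun i j => sinkhorn Y (i, j)) (mem_doublyStochastic_iff_sum.2
      ⟨fun i j => (sinkhorn_pos Y _).le, rowSum_sinkhorn Y, colSum_sinkhorn Y⟩)
  refine ⟨w, h0, h1, ?_⟩
  ext ⟨i, j⟩
  have := congrFun (congrFun h i) j
  simp only [Matrix.sum_apply, Matrix.smul_apply, Equiv.Perm.permMatrix,
    PEquiv.toMatrix_apply, Equiv.toPEquiv_apply, Option.mem_some_iff, Matrix.of_apply] at this
  rw [WithLp.ofLp_sum, Finset.sum_apply]
  exact this

lemma norm_permMat_sub_permMat_le {N : ℕ} (π π' : Equiv.Perm (Fin N)) :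
    ‖permMat π - permMat π'‖ ≤ N := by
  rw [← mul_one (N : ℝ)]
  refine norm_le_mul_of_forall_abs_le zero_le_one fun i j => ?_
  rw [PiLp.sub_apply, permMat_apply, permMat_apply]
  split_ifs <;> norm_num

lemma tempError_nonneg {N : ℕ} (τ : ℝ) (X : Mat N) : 0 ≤ tempError τ X := Metric.infDist_nonneg

lemma tempError_le {N : ℕ} (τ : ℝ) (X : Mat N) : tempError τ X ≤ N := by
  refine (Metric.infDist_le_dist_of_mem (Set.mem_range_self 1)).trans ?_
  rw [dist_eq_norm, ← mul_one (N : ℝ)]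
  refine norm_le_mul_of_forall_abs_le zero_le_one fun i j => ?_
  rw [PiLp.sub_apply]
  refine abs_sub_le_one (sinkhorn_pos _ _).le (sinkhorn_le_one _ _) ?_ ?_ <;>
  · rw [permMat_apply]
    split_ifs <;> norm_num

/-- A gap in the assignment problem makes the temperature error linear in the temperature. -/
lemma tempError_le_of_gap {N : ℕ} {τ γ : ℝ} (hτ : 0 < τ) (hγ : 0 < γ) {X : Mat N}
    {π : Equiv.Perm (Fin N)}
    (hX : ∀ π', π' ≠ π → inner ℝ (permMat π') X + γ ≤ inner ℝ (permMat π) X) :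
    tempError τ X ≤ (N : ℝ) ^ 3 / γ * τ := by
  obtain ⟨w, h0, h1, h⟩ := exists_sinkhorn_eq_sum_permMat (τ⁻¹ • X)
  -- Each unit of weight off `π` costs at least `γ` in reward, while the total loss is at most `N ^
  -- 2 * τ`.
  have hw : (∑ π', if π' = π then 0 else w π') * γ ≤ (N : ℝ) ^ 2 * τ := by
    have h2 := inner_permMat_sub_sinkhorn_le (τ⁻¹ • X) π
    rw [← h, sum_inner] at h2
    simp only [inner_smul_right, real_inner_smul_left] at h2
    have h3 : ∑ π', w π' * inner ℝ (permMat π') X +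
        (∑ π', if π' = π then 0 else w π') * γ ≤ inner ℝ (permMat π) X := by
      calc _ = ∑ π', (w π' * inner ℝ (permMat π') X + (if π' = π then 0 else w π') * γ) := by
            rw [Finset.sum_add_distrib, Finset.sum_mul]
        _ ≤ ∑ π', w π' * inner ℝ (permMat π) X := by
            refine Finset.sum_le_sum fun π' _ => ?_
            split_ifs with hπ
            · rw [hπ]; simp
            · rw [← mul_add]
              exact mul_le_mul_of_nonneg_left (hX π' hπ) (h0 π')
        _ = _ := by rw [← Finset.sum_mul, h1, one_mul]
    have h4 : τ⁻¹ * (inner ℝ (permMat π) X - ∑ π', w π' * inner ℝ (permMat π') X) ≤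
        (N : ℝ) ^ 2 := by
      refine le_trans (le_of_eq ?_) h2
      rw [mul_sub, Finset.mul_sum]
    rw [inv_mul_le_iff₀ hτ] at h4
    linarith
  refine (Metric.infDist_le_dist_of_mem (Set.mem_range_self π)).trans ?_
  have e : sinkhorn (τ⁻¹ • X) - permMat π = ∑ π', w π' • (permMat π' - permMat π) := by
    simp only [smul_sub, Finset.sum_sub_distrib]
    rw [← Finset.sum_smul, h1, one_smul, h]
  rw [dist_eq_norm, e]
  calc _ ≤ ∑ π', ‖w π' • (permMat π' - permMat π)‖ := norm_sum_le _ _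
    _ ≤ ∑ π', (if π' = π then 0 else w π') * N := by
        refine Finset.sum_le_sum fun π' _ => ?_
        split_ifs with hπ
        · simp [hπ]
        · rw [norm_smul, Real.norm_of_nonneg (h0 π')]
          exact mul_le_mul_of_nonneg_left (norm_permMat_sub_permMat_le _ _) (h0 π')
    _ = N * ∑ π', (if π' = π then 0 else w π') := by rw [← Finset.sum_mul, mul_comm]
    _ ≤ N * ((N : ℝ) ^ 2 * τ / γ) := by
        gcongr
        rwa [le_div_iff₀ hγ]
    _ = _ := by ring

/-- On a compact set of uniquely matched matrices the gap is bounded away from zero. -/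
lemma IsCompact.exists_assignment_gap {N : ℕ} {K : Set (Mat N)} (hK : IsCompact K)
    (hu : ∀ X ∈ K, HasUniqueAssignment X) : ∃ γ : ℝ, 0 < γ ∧ ∀ X ∈ K,
      ∃ π : Equiv.Perm (Fin N), ∀ π', π' ≠ π →
        inner ℝ (permMat π') X + γ ≤ inner ℝ (permMat π) X := by
  refine hK.induction_on (p := fun S => ∃ γ : ℝ, 0 < γ ∧ ∀ X ∈ S,
      ∃ π : Equiv.Perm (Fin N), ∀ π', π' ≠ π →
        inner ℝ (permMat π') X + γ ≤ inner ℝ (permMat π) X) ⟨1, one_pos, by simp⟩ ?_ ?_ ?_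
  · rintro s t hst ⟨γ, hγ, h⟩
    exact ⟨γ, hγ, fun X hX => h X (hst hX)⟩
  · rintro s t ⟨γ, hγ, h⟩ ⟨γ', hγ', h'⟩
    refine ⟨min γ γ', lt_min hγ hγ', ?_⟩
    rintro X (hX | hX)
    · obtain ⟨π, hπ⟩ := h X hX
      exact ⟨π, fun π' hne => by linarith [hπ π' hne, min_le_left γ γ']⟩
    · obtain ⟨π, hπ⟩ := h' X hX
      exact ⟨π, fun π' hne => by linarith [hπ π' hne, min_le_right γ γ']⟩
  · intro X hX
    obtain ⟨π, hπ⟩ := hu X hX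
    have hev (π' : Equiv.Perm (Fin N)) : ∃ γ : ℝ, 0 < γ ∧ (π' ≠ π →
        inner ℝ (permMat π') X + γ < inner ℝ (permMat π) X) := by
      by_cases hne : π' = π
      · exact ⟨1, one_pos, fun h => (h hne).elim⟩
      · refine ⟨(inner ℝ (permMat π) X - inner ℝ (permMat π') X) / 2, ?_, fun _ => ?_⟩ <;>
          linarith [hπ π' hne]
    choose γ hγ hlt using hev
    obtain ⟨π₀, hπ₀⟩ := Finite.exists_min γ
    refine ⟨{Z | ∀ π', π' ≠ π → inner ℝ (permMat π') Z + γ π₀ < inner ℝ (permMat π) Z},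
      mem_nhdsWithin_of_mem_nhds ?_, γ π₀, hγ π₀, fun Z hZ => ⟨π, fun π' hne => (hZ π' hne).le⟩⟩
    refine eventually_all.2 fun π' => ?_
    by_cases hne : π' = π
    · exact Eventually.of_forall fun Z h => (h hne).elim
    · have hopen : IsOpen {Z : Mat N | inner ℝ (permMat π') Z + γ π₀ < inner ℝ (permMat π) Z} :=
        isOpen_lt (by fun_prop) (by fun_prop)
      filter_upwards [hopen.mem_nhds
        (show inner ℝ (permMat π') X + γ π₀ < inner ℝ (permMat π) X by
          linarith [hlt π' hne, hπ₀ π'])] with Z hZ _ using hZ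

/-- For fixed `τ` the logits `X / τ` are bounded by `M / τ` on `K`, so a single rate serves them
all. Without unique matching the trivial temperature bound `N` suffices. -/
lemma exists_tempError_bound_and_rate {N : ℕ} {K : Set (Mat N)} (hK : IsCompact K) :
    ∃ s r : ℝ → ℝ,
      (∀ τ : ℝ, 0 < τ → ∀ X ∈ K,
        tempError τ X ≤ s τ ∧ IsSinkhornRate (2 * N + 2) (r τ) (τ⁻¹ • X)) ∧
      ((∀ X ∈ K, HasUniqueAssignment X) → Tendsto s (𝓝[>] 0) (𝓝 0)) := by
  obtain ⟨M, hM⟩ := hK.isBounded.exists_norm_le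
  choose r hr using exists_isSinkhornRate N
  have hrate (τ : ℝ) (hτ : 0 < τ) (X : Mat N) (hX : X ∈ K) :
      IsSinkhornRate (2 * N + 2) (r (τ⁻¹ * M)) (τ⁻¹ • X) := by
    refine hr _ _ fun p => (abs_apply_le_norm _ p).trans ?_
    rw [norm_smul, Real.norm_of_nonneg (inv_nonneg.2 hτ.le)]
    exact mul_le_mul_of_nonneg_left (hM X hX) (inv_nonneg.2 hτ.le)
  by_cases hu : ∀ X ∈ K, HasUniqueAssignment X
  · obtain ⟨γ, hγ, hgap⟩ := hK.exists_assignment_gap hu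
    refine ⟨fun τ => (N : ℝ) ^ 3 / γ * τ, fun τ => r (τ⁻¹ * M), fun τ hτ X hX => ?_, fun _ => ?_⟩
    · obtain ⟨π, hπ⟩ := hgap X hX
      exact ⟨tempError_le_of_gap hτ hγ hπ, hrate τ hτ X hX⟩
    · have : Tendsto (fun τ : ℝ => (N : ℝ) ^ 3 / γ * τ) (𝓝 0) (𝓝 ((N : ℝ) ^ 3 / γ * 0)) :=
        (continuous_const.mul continuous_id).tendsto 0
      rw [mul_zero] at this
      exact this.mono_left nhdsWithin_le_nhds
  · exact ⟨fun _ => N, fun τ => r (τ⁻¹ * M),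
      fun τ hτ X hX => ⟨tempError_le τ X, hrate τ hτ X hX⟩, fun h => (hu h).elim⟩

/-! ### Smooth functions -/

lemma IsLSmooth.continuous_gradient {N : ℕ} {L : ℝ} {f : Mat N → ℝ} (hf : IsLSmooth L f) :
    Continuous (gradient f) :=
  (LipschitzWith.of_dist_le' fun P Q => by
    rw [dist_eq_norm, dist_eq_norm]
    exact hf.2 P Q).continuous

/-- The descent lemma. -/
lemma IsLSmooth.le_add_inner_add {N : ℕ} {L : ℝ} {f : Mat N → ℝ} (hf : IsLSmooth L f)
    (P v : Mat N) : f (P + v) ≤ f P + inner ℝ (gradient f P) v + L / 2 * ‖v‖ ^ 2 := by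
  -- The defect of the quadratic upper bound along the segment; the Lipschitz bound makes its
  -- derivative nonpositive.
  set φ : ℝ → ℝ := fun t => f (P + t • v) - t * inner ℝ (gradient f P) v - L / 2 * t ^ 2 * ‖v‖ ^ 2
  have hd (t : ℝ) : HasDerivAt φ (inner ℝ (gradient f (P + t • v)) v - inner ℝ (gradient f P) v
      - L * t * ‖v‖ ^ 2) t := by
    have h1 : HasDerivAt (fun t : ℝ => P + t • v) v t := by
      simpa using ((hasDerivAt_id t).smul_const v).const_add P
    have h2 := (hf.1 (P + t • v)).hasGradientAt.hasFDerivAt.comp_hasDerivAt t h1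
    rw [InnerProductSpace.toDual_apply_apply] at h2
    have h3 := (h2.sub ((hasDerivAt_id t).mul_const (inner ℝ (gradient f P) v))).sub
      ((((hasDerivAt_id t).pow 2).const_mul (L / 2)).mul_const (‖v‖ ^ 2))
    refine h3.congr_deriv ?_
    simp only [id_eq, Nat.cast_ofNat]
    ring
  have hanti : AntitoneOn φ (Set.Icc 0 1) := by
    refine antitoneOn_of_deriv_nonpos (convex_Icc 0 1)
      (fun t _ => (hd t).continuousAt.continuousWithinAt)
      (fun t _ => (hd t).differentiableAt.differentiableWithinAt) fun t ht => ?_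
    rw [interior_Icc] at ht
    rw [(hd t).deriv, ← inner_sub_left]
    have h1 := real_inner_le_norm (gradient f (P + t • v) - gradient f P) v
    have h2 := hf.2 (P + t • v) P
    rw [add_sub_cancel_left, norm_smul, Real.norm_of_nonneg ht.1.le] at h2
    have h3 := mul_le_mul_of_nonneg_right h2 (norm_nonneg v)
    nlinarith
  have := hanti (Set.left_mem_Icc.2 zero_le_one) (Set.right_mem_Icc.2 zero_le_one) zero_le_one
  simp only [φ, one_smul, zero_smul, add_zero] at this
  linarith

/-! ### Measurability and boundedness -/

lemma measurable_rowNormalize {N : ℕ} : Measurable (rowNormalize (N := N)) := by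
  unfold rowNormalize
  fun_prop

lemma measurable_colNormalize {N : ℕ} : Measurable (colNormalize (N := N)) := by
  unfold colNormalize
  fun_prop

lemma measurable_sinkhornIter {N : ℕ} (k : ℕ) : Measurable (sinkhornIter (N := N) k) := by
  induction k with
  | zero =>
    rw [show sinkhornIter (N := N) 0 = fun X => WithLp.toLp 2 fun p => Real.exp (X p) from rfl]
    fun_prop
  | succ k ih => exact measurable_colNormalize.comp (measurable_rowNormalize.comp ih)

lemma measurable_sinkhorn {N : ℕ} : Measurable (sinkhorn (N := N)) :=
  measurable_of_tendsto_metrizable measurable_sinkhornIter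
    (tendsto_pi_nhds.2 tendsto_sinkhornIter)

lemma measurable_tempError {N : ℕ} (τ : ℝ) : Measurable (tempError (N := N) τ) :=
  (Metric.continuous_infDist_pt _).measurable.comp
    (measurable_sinkhorn.comp (measurable_const_smul τ⁻¹))

lemma norm_sinkhornIter_le {N k : ℕ} (hk : 1 ≤ k) (Y : Mat N) : ‖sinkhornIter k Y‖ ≤ N := by
  obtain ⟨k, rfl⟩ := Nat.exists_eq_add_of_le' hk
  rw [← mul_one (N : ℝ)]
  refine norm_le_mul_of_forall_abs_le zero_le_one fun i j => ?_
  have := neZero_of_fin i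
  rw [abs_of_pos (sinkhornIter_pos _ Y i j)]
  exact sinkhornIter_le_one k Y i j

lemma norm_permMat_le {N : ℕ} (π : Equiv.Perm (Fin N)) : ‖permMat π‖ ≤ N := by
  rw [← mul_one (N : ℝ)]
  refine norm_le_mul_of_forall_abs_le zero_le_one fun i j => ?_
  rw [permMat_apply]
  split_ifs <;> norm_num

/-- Continuous maps are bounded on closed balls of a proper space. Normalized iterates and
permutation matrices have norm at most `N`, so `f` and its gradient are bounded along the run up to
time `T`. -/
lemma memLp_comp_of_norm_le {E F Ω : Type*} [NormedAddCommGroup E] [ProperSpace E]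
    [NormedAddCommGroup F] [MeasurableSpace Ω] {μ : Measure Ω} [IsFiniteMeasure μ] {φ : E → F}
    (hφ : Continuous φ) {Z : Ω → E} (hZ : AEStronglyMeasurable Z μ) {R : ℝ}
    (hR : ∀ ω, ‖Z ω‖ ≤ R) (p : ENNReal) : MemLp (fun ω => φ (Z ω)) p μ := by
  obtain ⟨c, hc⟩ := (isCompact_closedBall (0 : E) R).exists_bound_of_continuousOn hφ.continuousOn
  exact MemLp.of_bound (hφ.comp_aestronglyMeasurable hZ) c <| ae_of_all _ fun ω =>
    hc _ (mem_closedBall_zero_iff.2 (hR ω))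

/-! ### The Hungarian method -/

lemma norm_permMat_sq {N : ℕ} (π : Equiv.Perm (Fin N)) : ‖permMat π‖ ^ 2 = N := by
  rw [← real_inner_self_eq_norm_sq, inner_eq_sum]
  simp [permMat_apply]

/-- The Hungarian output is a nearest permutation matrix. -/
lemma IsHungarianOutput.norm_sub_le {N : ℕ} {G P : Mat N} (h : IsHungarianOutput G P) :
    ‖G - P‖ ≤ Metric.infDist G (Set.range permMat) := by
  obtain ⟨π, rfl, hπ⟩ := h
  refine (Metric.le_infDist (Set.range_nonempty _)).2 ?_
  rintro _ ⟨π', rfl⟩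
  rw [dist_eq_norm]
  refine le_of_sq_le_sq ?_ (norm_nonneg _)
  -- All permutation matrices have the same norm, so maximizing the inner product with `G` minimizes
  -- the distance to `G`.
  rw [norm_sub_sq_real, norm_sub_sq_real, norm_permMat_sq, norm_permMat_sq, real_inner_comm,
    real_inner_comm (permMat π')]
  linarith [hπ π']

lemma norm_sub_sq_le_of_isSinkhornRate {N k : ℕ} {A r τ : ℝ} {X P : Mat N} (hk : 1 ≤ k)
    (hr : IsSinkhornRate A r (τ⁻¹ • X))
    (hP : IsHungarianOutput (sinkhornIter k (τ⁻¹ • X)) P) :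
    ‖sinkhornIter k (τ⁻¹ • X) - P‖ ^ 2 ≤
      (2 + 2 * A ^ 2) * (tempError τ X ^ 2 + r ^ (2 * k)) := by
  have h1 : ‖sinkhornIter k (τ⁻¹ • X) - P‖ ≤ tempError τ X + A * r ^ k := by
    refine hP.norm_sub_le.trans ((Metric.infDist_le_infDist_add_dist
      (y := sinkhorn (τ⁻¹ • X))).trans ?_)
    rw [dist_eq_norm]
    exact add_le_add le_rfl (hr.2.2 k hk)
  have h2 := pow_le_pow_left₀ (norm_nonneg _) h1 2
  rw [mul_comm 2 k, pow_mul]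
  nlinarith [sq_nonneg (tempError τ X - A * r ^ k), sq_nonneg (A * tempError τ X),
    sq_nonneg (r ^ k)]

/-! ### Expected descent -/

lemma uniformExpect_mono {Ω : Type*} [MeasurableSpace Ω] {μ : Measure Ω} {T : ℕ}
    {F G : ℕ → Ω → ℝ} (h : ∀ t ≤ T, ∫ ω, F t ω ∂μ ≤ ∫ ω, G t ω ∂μ) :
    uniformExpect μ T F ≤ uniformExpect μ T G :=
  Finset.sum_le_sum fun t ht => mul_le_mul_of_nonneg_left
    (h t (Nat.lt_succ_iff.1 (Finset.mem_range.1 ht))) (by positivity)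

lemma uniformExpect_const_mul {Ω : Type*} [MeasurableSpace Ω] {μ : Measure Ω} {T : ℕ} (c : ℝ)
    (F : ℕ → Ω → ℝ) :
    uniformExpect μ T (fun t ω => c * F t ω) = c * uniformExpect μ T F := by
  simp only [uniformExpect, integral_const_mul, Finset.mul_sum]
  exact Finset.sum_congr rfl fun _ _ => by ring

lemma uniformExpect_const {Ω : Type*} [MeasurableSpace Ω] {μ : Measure Ω} [IsProbabilityMeasure μ]
    {T : ℕ} (c : ℝ) : uniformExpect μ T (fun _ _ => c) = c := by
  have : (T : ℝ) + 1 ≠ 0 := by positivity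
  simp [uniformExpect]
  field_simp

section Run

variable {N : ℕ} {Ω : Type*} [mΩ : MeasurableSpace Ω] {μ : Measure Ω}
  {ℱ : Filtration ℕ mΩ} {f : Mat N → ℝ} {L σ η τ : ℝ} {k T : ℕ} {P0 : Mat N}
  {X PGS Preal g : ℕ → Ω → Mat N} {t : ℕ}

lemma IsPSTERun.stronglyMeasurable_PGS (h : IsPSTERun μ ℱ f σ η τ k T P0 X PGS Preal g)
    (ht : t ≤ T) : StronglyMeasurable[ℱ t] (PGS t) := by
  rw [show PGS t = fun ω => sinkhornIter k (τ⁻¹ • X t ω) from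
    funext fun ω => h.gumbel_sinkhorn t ht ω]
  exact ((measurable_sinkhornIter k).comp
    ((measurable_const_smul τ⁻¹).comp (h.logit_adapted t ht).measurable)).stronglyMeasurable

lemma IsPSTERun.norm_PGS_le (h : IsPSTERun μ ℱ f σ η τ k T P0 X PGS Preal g) (hk : 1 ≤ k)
    (ht : t ≤ T) (ω : Ω) : ‖PGS t ω‖ ≤ N := by
  rw [h.gumbel_sinkhorn t ht]
  exact norm_sinkhornIter_le hk _

lemma IsPSTERun.norm_Preal_le (h : IsPSTERun μ ℱ f σ η τ k T P0 X PGS Preal g)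
    (ht : t ≤ T) (ω : Ω) : ‖Preal t ω‖ ≤ N := by
  obtain ⟨π, hπ, -⟩ := h.hungarian t ht ω
  rw [hπ]
  exact norm_permMat_le π

lemma IsPSTERun.memLp_gradient_PGS [IsProbabilityMeasure μ]
    (h : IsPSTERun μ ℱ f σ η τ k T P0 X PGS Preal g)
    (hf : IsLSmooth L f) (hk : 1 ≤ k) (ht : t ≤ T) :
    MemLp (fun ω => gradient f (PGS t ω)) 2 μ :=
  memLp_comp_of_norm_le hf.continuous_gradient
    ((h.stronglyMeasurable_PGS ht).mono (ℱ.le t)).aestronglyMeasurable (h.norm_PGS_le hk ht) 2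

lemma IsPSTERun.memLp_gradient_Preal [IsProbabilityMeasure μ]
    (h : IsPSTERun μ ℱ f σ η τ k T P0 X PGS Preal g)
    (hf : IsLSmooth L f) (ht : t ≤ T) : MemLp (fun ω => gradient f (Preal t ω)) 2 μ :=
  memLp_comp_of_norm_le hf.continuous_gradient
    ((h.real_adapted t ht).mono (ℱ.le t)).aestronglyMeasurable (h.norm_Preal_le ht) 2

lemma IsPSTERun.memLp_sub [IsProbabilityMeasure μ]
    (h : IsPSTERun μ ℱ f σ η τ k T P0 X PGS Preal g)
    (hk : 1 ≤ k) (ht : t ≤ T) : MemLp (fun ω => PGS t ω - Preal t ω) 2 μ :=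
  (memLp_comp_of_norm_le continuous_id
    ((h.stronglyMeasurable_PGS ht).mono (ℱ.le t)).aestronglyMeasurable (h.norm_PGS_le hk ht) 2).sub
  (memLp_comp_of_norm_le continuous_id
    ((h.real_adapted t ht).mono (ℱ.le t)).aestronglyMeasurable (h.norm_Preal_le ht) 2)

lemma integrable_inner_of_memLp_two {F G : Ω → Mat N} (hF : MemLp F 2 μ) (hG : MemLp G 2 μ) :
    Integrable (fun ω => inner ℝ (F ω) (G ω)) μ := by
  refine Integrable.mono' (hF.integrable_norm_pow two_ne_zero |>.add
    (hG.integrable_norm_pow two_ne_zero)) (hF.1.inner hG.1) (ae_of_all _ fun ω => ?_)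
  have h1 := norm_inner_le_norm (𝕜 := ℝ) (F ω) (G ω)
  simp only [Pi.add_apply]
  nlinarith [sq_nonneg (‖F ω‖ - ‖G ω‖), sq_nonneg ‖F ω‖, sq_nonneg ‖G ω‖]

/-- The stochastic gradient may be replaced by its conditional mean. -/
lemma IsPSTERun.integral_inner_eq [IsProbabilityMeasure μ]
    (h : IsPSTERun μ ℱ f σ η τ k T P0 X PGS Preal g)
    (hf : IsLSmooth L f) (hk : 1 ≤ k) (ht : t ≤ T) :
    ∫ ω, inner ℝ (gradient f (PGS t ω)) (g t ω) ∂μ =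
      ∫ ω, inner ℝ (gradient f (PGS t ω)) (gradient f (Preal t ω)) ∂μ := by
  have hint := integrable_inner_of_memLp_two (h.memLp_gradient_PGS hf hk ht) (h.grad_memLp t ht)
  -- `PGS t` is a function of `X t`, so its gradient is `ℱ t`-measurable and can be pulled out of
  -- the conditional expectation.
  have hpull := condExp_bilin_of_stronglyMeasurable_left (innerSL ℝ)
    (hf.continuous_gradient.comp_stronglyMeasurable (h.stronglyMeasurable_PGS ht)) hint
    ((h.grad_memLp t ht).integrable one_le_two)
  rw [← integral_condExp (ℱ.le t)]
  refine integral_congr_ae (hpull.trans ?_)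
  filter_upwards [h.grad_unbiased t ht] with ω hω
  rw [hω]
  rfl

lemma IsPSTERun.descent_step (h : IsPSTERun μ ℱ f σ η τ k T P0 X PGS Preal g)
    (hf : IsLSmooth L f) (ht : t ≤ T) (ω : Ω) :
    f (PGS (t + 1) ω) ≤ f (PGS t ω) - η * inner ℝ (gradient f (PGS t ω)) (g t ω) +
      L / 2 * η ^ 2 * ‖g t ω‖ ^ 2 := by
  have := hf.le_add_inner_add (PGS t ω) (-(η • g t ω))
  rw [inner_neg_right, inner_smul_right, norm_neg, norm_smul, mul_pow, Real.norm_eq_abs, sq_abs,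
    ← sub_eq_add_neg, ← h.update t ht] at this
  linarith

lemma IsPSTERun.integrable_descent_bound [IsProbabilityMeasure μ]
    (h : IsPSTERun μ ℱ f σ η τ k T P0 X PGS Preal g)
    (hf : IsLSmooth L f) (hk : 1 ≤ k) (ht : t ≤ T) :
    Integrable (fun ω => f (PGS t ω) - η * inner ℝ (gradient f (PGS t ω)) (g t ω) +
      L / 2 * η ^ 2 * ‖g t ω‖ ^ 2) μ :=
  ((memLp_one_iff_integrable.1 (memLp_comp_of_norm_le hf.1.continuous
    ((h.stronglyMeasurable_PGS ht).mono (ℱ.le t)).aestronglyMeasurable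
    (h.norm_PGS_le hk ht) 1)).sub ((integrable_inner_of_memLp_two
      (h.memLp_gradient_PGS hf hk ht) (h.grad_memLp t ht)).const_mul η)).add
    (((h.grad_memLp t ht).integrable_norm_pow two_ne_zero).const_mul _)

/-- `PGS (T + 1)` need not be a Sinkhorn iterate, hence need not be bounded; there `f` is squeezed
between `m` and the descent bound. -/
lemma IsPSTERun.integrable_comp_PGS [IsProbabilityMeasure μ]
    (h : IsPSTERun μ ℱ f σ η τ k T P0 X PGS Preal g)
    (hf : IsLSmooth L f) (hk : 1 ≤ k) {m : ℝ} (hm : ∀ᵐ ω ∂μ, m ≤ f (PGS (T + 1) ω))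
    (ht : t ≤ T + 1) : Integrable (fun ω => f (PGS t ω)) μ := by
  have hmeas {t : ℕ} (ht : t ≤ T) : AEStronglyMeasurable (PGS t) μ :=
    ((h.stronglyMeasurable_PGS ht).mono (ℱ.le t)).aestronglyMeasurable
  rcases Nat.le_succ_iff.1 ht with ht | rfl
  · exact memLp_one_iff_integrable.1
      (memLp_comp_of_norm_le hf.1.continuous (hmeas ht) (h.norm_PGS_le hk ht) 1)
  · refine integrable_of_le_of_le ?_ hm (ae_of_all _ (h.descent_step hf le_rfl))
      (integrable_const m) (h.integrable_descent_bound hf hk le_rfl)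
    refine hf.1.continuous.comp_aestronglyMeasurable ?_
    rw [show PGS (T + 1) = fun ω => PGS T ω - η • g T ω from funext (h.update T le_rfl)]
    exact (hmeas le_rfl).sub ((h.grad_memLp T le_rfl).1.const_smul η)

lemma IsPSTERun.integral_descent [IsProbabilityMeasure μ]
    (h : IsPSTERun μ ℱ f σ η τ k T P0 X PGS Preal g)
    (hf : IsLSmooth L f) (hL : 0 < L) (hη : 0 ≤ η) (hk : 1 ≤ k) {m : ℝ}
    (hm : ∀ᵐ ω ∂μ, m ≤ f (PGS (T + 1) ω)) (ht : t ≤ T) :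
    η / 2 * ∫ ω, ‖gradient f (Preal t ω)‖ ^ 2 ∂μ ≤
      (∫ ω, f (PGS t ω) ∂μ - ∫ ω, f (PGS (t + 1) ω) ∂μ) +
      η / 2 * L ^ 2 * ∫ ω, ‖PGS t ω - Preal t ω‖ ^ 2 ∂μ + L / 2 * η ^ 2 * σ ^ 2 := by
  have hGS := h.memLp_gradient_PGS hf hk ht
  have hre := h.memLp_gradient_Preal hf ht
  have hIt := h.integrable_comp_PGS hf hk hm (ht.trans (Nat.le_succ T))
  have hIg := ((h.grad_memLp t ht).integrable_norm_pow two_ne_zero)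
  have hin := integrable_inner_of_memLp_two hGS (h.grad_memLp t ht)
  have hsub := (h.memLp_sub hk ht).integrable_norm_pow two_ne_zero
  have hre2 := hre.integrable_norm_pow two_ne_zero
  have h1 := integral_mono (h.integrable_comp_PGS hf hk hm (Nat.succ_le_succ ht))
    (h.integrable_descent_bound hf hk ht) (h.descent_step hf ht)
  have hadd := integral_add (hIt.sub (hin.const_mul η)) (hIg.const_mul (L / 2 * η ^ 2))
  simp only [Pi.sub_apply] at hadd
  rw [hadd,
    integral_sub hIt (hin.const_mul η), integral_const_mul, integral_const_mul,
    h.integral_inner_eq hf hk ht] at h1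
  -- Polarization: `⟨a, b⟩ ≥ ‖b‖² / 2 - ‖a - b‖² / 2`, with `‖a - b‖` bounded by the Lipschitz
  -- property; the term `‖a‖² / 2` is dropped.
  have h2 := integral_mono (((hre2.const_mul (1 / 2)).sub
    (hsub.const_mul (L ^ 2 / 2)))) (integrable_inner_of_memLp_two hGS hre) (fun ω => by
      have e := norm_sub_sq_real (gradient f (PGS t ω)) (gradient f (Preal t ω))
      have l := pow_le_pow_left₀ (norm_nonneg _) (hf.2 (PGS t ω) (Preal t ω)) 2
      rw [mul_pow] at l
      simp only [Pi.sub_apply]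
      nlinarith [sq_nonneg ‖gradient f (PGS t ω)‖])
  simp only [Pi.sub_apply] at h2
  rw [integral_sub (hre2.const_mul _) (hsub.const_mul _), integral_const_mul,
    integral_const_mul] at h2
  have h3 := mul_le_mul_of_nonneg_left h2 hη
  have h4 := mul_le_mul_of_nonneg_left (h.grad_bound t ht)
    (by positivity : 0 ≤ L / 2 * η ^ 2)
  linarith

/-- Convergence of PSTE up to the mean squared discretization error. -/
lemma IsPSTERun.uniformExpect_gradient_le [IsProbabilityMeasure μ]
    {Pstar : Mat N}
    (h : IsPSTERun μ ℱ f σ (Real.sqrt ((f P0 - f Pstar) / (L * σ ^ 2)) / Real.sqrt T) τ k T P0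
      X PGS Preal g) (hL : 0 < L) (hσ : 0 < σ) (hk : 1 ≤ k) (hT : 1 ≤ T) (hf : IsLSmooth L f)
    (hstar : ∀ t ≤ T + 1, ∀ᵐ ω ∂μ, f Pstar ≤ f (PGS t ω))
    (hgrad : f P0 = f Pstar → gradient f P0 = 0) :
    uniformExpect μ T (fun t ω => ‖gradient f (Preal t ω)‖ ^ 2) ≤
      3 * (σ * Real.sqrt ((f P0 - f Pstar) / (T / L))) +
        L ^ 2 * uniformExpect μ T (fun t ω => ‖PGS t ω - Preal t ω‖ ^ 2) := by
  have hT0 : (0 : ℝ) < T := Nat.cast_pos.2 hT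
  have hle : f Pstar ≤ f P0 := by
    obtain ⟨ω, hω⟩ := (hstar 0 (Nat.zero_le _)).exists
    rwa [h.init] at hω
  rcases hle.eq_or_lt with heq | hlt
  · have hconst : ∀ t ≤ T + 1, ∀ ω, PGS t ω = P0 := by
      intro t
      induction t with
      | zero => exact fun _ => h.init
      | succ t ih =>
        intro ht ω
        rw [h.update t (Nat.succ_le_succ_iff.1 ht), ih (by omega), heq]
        simp
    rw [heq, sub_self, zero_div, Real.sqrt_zero, mul_zero, mul_zero, zero_add,
      ← uniformExpect_const_mul]
    refine uniformExpect_mono fun t ht => integral_mono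
      ((h.memLp_gradient_Preal hf ht).integrable_norm_pow two_ne_zero)
      (((h.memLp_sub hk ht).integrable_norm_pow two_ne_zero).const_mul _) fun ω => ?_
    have := hf.2 (PGS t ω) (Preal t ω)
    rw [hconst t (ht.trans (Nat.le_succ T)), hgrad heq.symm, zero_sub, norm_neg] at this
    simp only
    rw [← mul_pow, hconst t (ht.trans (Nat.le_succ T))]
    exact pow_le_pow_left₀ (norm_nonneg _) this 2
  · have hΔ : 0 < f P0 - f Pstar := sub_pos.2 hlt
    set Δ := f P0 - f Pstar
    set w := Real.sqrt (Δ / (T / L)) with hw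
    have hw0 : 0 < w := Real.sqrt_pos.2 (by positivity)
    have hw2 : w ^ 2 = Δ / (T / L) := Real.sq_sqrt (by positivity)
    have hη : Real.sqrt (Δ / (L * σ ^ 2)) / Real.sqrt T = w / (L * σ) := by
      rw [← Real.sqrt_div (by positivity), eq_comm, ← Real.sqrt_sq (by positivity :
        0 ≤ w / (L * σ)), div_pow, hw2]
      congr 1
      field_simp
    rw [hη] at h
    have hsum := Finset.sum_le_sum fun t (ht : t ∈ Finset.range (T + 1)) =>
      h.integral_descent hf hL (by positivity : 0 ≤ w / (L * σ)) hk (hstar (T + 1) le_rfl)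
        (Nat.lt_succ_iff.1 (Finset.mem_range.1 ht))
    rw [Finset.sum_add_distrib, Finset.sum_add_distrib,
      Finset.sum_range_sub' (fun t => ∫ ω, f (PGS t ω) ∂μ), ← Finset.mul_sum, ← Finset.mul_sum,
      Finset.sum_const, Finset.card_range, nsmul_eq_mul] at hsum
    have h0 : ∫ ω, f (PGS 0 ω) ∂μ = f P0 := by simp [h.init]
    have h1 : f Pstar ≤ ∫ ω, f (PGS (T + 1) ω) ∂μ := by
      have := integral_mono_ae (integrable_const (f Pstar))
        (h.integrable_comp_PGS hf hk (hstar (T + 1) le_rfl) le_rfl) (hstar (T + 1) le_rfl)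
      simpa using this
    simp only [uniformExpect, ← Finset.mul_sum]
    set S := ∑ t ∈ Finset.range (T + 1), ∫ ω, ‖gradient f (Preal t ω)‖ ^ 2 ∂μ
    set D := ∑ t ∈ Finset.range (T + 1), ∫ ω, ‖PGS t ω - Preal t ω‖ ^ 2 ∂μ
    have h2 : w / (L * σ) / 2 * S ≤ Δ + w / (L * σ) / 2 * L ^ 2 * D +
        (T + 1) * (L / 2 * (w / (L * σ)) ^ 2 * σ ^ 2) := by
      push_cast at hsum
      linarith
    -- With `η = w / (L * σ)`, factoring out `η / 2` turns the initial gap into `2 * T * w * σ` and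
    -- the variance into `(T + 1) * w * σ`; together they give the constant `3`.
    have hΔw : Δ = w / (L * σ) / 2 * (2 * T * w * σ) := by
      have : Δ = w ^ 2 * (T / L) := by rw [hw2]; field_simp
      rw [this]
      field_simp
    have hlast : (T + 1) * (L / 2 * (w / (L * σ)) ^ 2 * σ ^ 2) =
        w / (L * σ) / 2 * ((T + 1) * w * σ) := by
      field_simp
    rw [hlast, hΔw, mul_assoc _ (L ^ 2) D, ← mul_add, ← mul_add] at h2
    have h3 := le_of_mul_le_mul_left h2 (by positivity)
    have hT1 : (0 : ℝ) < T + 1 := by positivity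
    have hwσ : 0 < w * σ := mul_pos hw0 hσ
    rw [one_div, inv_mul_le_iff₀ hT1]
    have e : ((T : ℝ) + 1) * (3 * (σ * w) + L ^ 2 * ((T + 1 : ℝ)⁻¹ * D)) =
      3 * (T + 1) * (w * σ) + L ^ 2 * D := by field_simp
    rw [e]
    linarith

lemma IsPSTERun.norm_sub_sq_le (h : IsPSTERun μ ℱ f σ η τ k T P0 X PGS Preal g) (hk : 1 ≤ k)
    (ht : t ≤ T) {A r : ℝ} {ω : Ω} (hr : IsSinkhornRate A r (τ⁻¹ • X t ω)) :
    ‖PGS t ω - Preal t ω‖ ^ 2 ≤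
      (2 + 2 * A ^ 2) * (tempError τ (X t ω) ^ 2 + r ^ (2 * k)) := by
  have hH := h.hungarian t ht ω
  rw [h.gumbel_sinkhorn t ht] at hH ⊢
  exact norm_sub_sq_le_of_isSinkhornRate hk hr hH

lemma IsPSTERun.uniformExpect_sub_le_const [IsProbabilityMeasure μ]
    (h : IsPSTERun μ ℱ f σ η τ k T P0 X PGS Preal g)
    (hk : 1 ≤ k) {A s r : ℝ} (hsr : ∀ t ≤ T, ∀ᵐ ω ∂μ,
      tempError τ (X t ω) ≤ s ∧ IsSinkhornRate A r (τ⁻¹ • X t ω)) :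
    uniformExpect μ T (fun t ω => ‖PGS t ω - Preal t ω‖ ^ 2) ≤
      (2 + 2 * A ^ 2) * (s ^ 2 + r ^ (2 * k)) := by
  rw [← uniformExpect_const (μ := μ) (T := T) ((2 + 2 * A ^ 2) * (s ^ 2 + r ^ (2 * k)))]
  refine uniformExpect_mono fun t ht => integral_mono_ae
    ((h.memLp_sub hk ht).integrable_norm_pow two_ne_zero) (integrable_const _) ?_
  filter_upwards [hsr t ht] with ω hω
  refine (h.norm_sub_sq_le hk ht hω.2).trans ?_
  have := pow_le_pow_left₀ (tempError_nonneg τ (X t ω)) hω.1 2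
  gcongr

/-- The summands are bounded by `N ^ 2` and `1`. Integrability matters because a non-integrable
function has Bochner integral `0`, which would spoil the comparison of expectations. -/
lemma IsPSTERun.integrable_tempError_sq_add [IsProbabilityMeasure μ]
    (h : IsPSTERun μ ℱ f σ η τ k T P0 X PGS Preal g)
    (ht : t ≤ T) {A : ℝ} {r : Ω → ℝ} (hmeas : AEStronglyMeasurable r μ)
    (hr : ∀ᵐ ω ∂μ, IsSinkhornRate A (r ω) (τ⁻¹ • X t ω)) :
    Integrable (fun ω => tempError τ (X t ω) ^ 2 + r ω ^ (2 * k)) μ := by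
  have hX : Measurable (X t) := ((h.logit_adapted t ht).mono (ℱ.le t)).measurable
  refine Integrable.add (Integrable.of_bound
    (((measurable_tempError τ).comp hX).pow_const 2).aestronglyMeasurable ((N : ℝ) ^ 2)
    (ae_of_all _ fun ω => ?_)) (Integrable.of_bound (hmeas.pow (2 * k)) 1 ?_)
  · rw [Real.norm_of_nonneg (sq_nonneg _)]
    exact pow_le_pow_left₀ (tempError_nonneg _ _) (tempError_le _ _) 2
  · filter_upwards [hr] with ω hω
    rw [Real.norm_of_nonneg (pow_nonneg hω.1.le _)]
    exact pow_le_one₀ hω.1.le hω.2.1.le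

lemma IsPSTERun.uniformExpect_sub_le [IsProbabilityMeasure μ]
    (h : IsPSTERun μ ℱ f σ η τ k T P0 X PGS Preal g)
    (hk : 1 ≤ k) {A : ℝ} {r : ℕ → Ω → ℝ} (hmeas : ∀ t ≤ T, AEStronglyMeasurable (r t) μ)
    (hr : ∀ t ≤ T, ∀ᵐ ω ∂μ, IsSinkhornRate A (r t ω) (τ⁻¹ • X t ω)) :
    uniformExpect μ T (fun t ω => ‖PGS t ω - Preal t ω‖ ^ 2) ≤ (2 + 2 * A ^ 2) *
      uniformExpect μ T (fun t ω => tempError τ (X t ω) ^ 2 + r t ω ^ (2 * k)) := by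
  rw [← uniformExpect_const_mul]
  refine uniformExpect_mono fun t ht => integral_mono_ae
    ((h.memLp_sub hk ht).integrable_norm_pow two_ne_zero)
    ((h.integrable_tempError_sq_add ht (hmeas t ht) (hr t ht)).const_mul _) ?_
  filter_upwards [hr t ht] with ω hω using h.norm_sub_sq_le hk ht hω

end Run

/-! ### Assembling the constant -/

lemma le_mul_add_of_le {A L x y z u : ℝ} (hx : 0 ≤ x) (hyz : y ≤ (2 + 2 * A ^ 2) * z)
    (hy : 0 ≤ y) (hu : u ≤ 3 * x + L ^ 2 * y) : u ≤ (3 + 2 * A ^ 2) * (x + L ^ 2 * z) := by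
  have hz : 0 ≤ z := nonneg_of_mul_nonneg_right (hy.trans hyz) (by positivity)
  have h1 := mul_le_mul_of_nonneg_left hyz (sq_nonneg L)
  nlinarith [mul_nonneg (sq_nonneg A) hx, mul_nonneg (sq_nonneg L) hz]

lemma uniformExpect_nonneg {Ω : Type*} [MeasurableSpace Ω] {μ : Measure Ω} {T : ℕ}
    {F : ℕ → Ω → ℝ} (hF : ∀ t ω, 0 ≤ F t ω) : 0 ≤ uniformExpect μ T F :=
  Finset.sum_nonneg fun t _ => mul_nonneg (by positivity) (integral_nonneg (hF t))

theorem theorem1 (N : ℕ) :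
    -- the temperature error vanishes as `τ → 0⁺`, and Sinkhorn's iteration has a rate `r < 1`
    (∃ A : ℝ, 0 < A ∧ ∀ K : Set (Mat N), IsCompact K →
      ∃ s r : ℝ → ℝ,
        (∀ τ : ℝ, 0 < τ → ∀ X ∈ K, tempError τ X ≤ s τ ∧ IsSinkhornRate A (r τ) (τ⁻¹ • X)) ∧
        ((∀ X ∈ K, HasUniqueAssignment X) → Tendsto s (𝓝[>] 0) (𝓝 0))) ∧
    -- convergence of PSTE
    (∀ A : ℝ, 0 < A → ∃ C : ℝ, 0 < C ∧
      ∀ (Ω : Type*) [mΩ : MeasurableSpace Ω] (μ : Measure Ω) [IsProbabilityMeasure μ]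
        (ℱ : Filtration ℕ mΩ) (f : Mat N → ℝ) (L σ τ : ℝ) (k T : ℕ) (P0 Pstar : Mat N)
        (X PGS Preal g : ℕ → Ω → Mat N),
        0 < L → 0 < σ → 0 < τ → 1 ≤ k → 1 ≤ T →
        IsLSmooth L f →
        IsPSTERun μ ℱ f σ
          (Real.sqrt ((f P0 - f Pstar) / (L * σ ^ 2)) / Real.sqrt T) τ k T P0 X PGS Preal g →
        (∀ t ≤ T + 1, ∀ᵐ ω ∂μ, f Pstar ≤ f (PGS t ω)) →
        (f P0 = f Pstar → gradient f P0 = 0) →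
        -- one `s` and one `r` for all logits of the run
        (∀ s r : ℝ,
          (∀ t ≤ T, ∀ᵐ ω ∂μ, tempError τ (X t ω) ≤ s ∧ IsSinkhornRate A r (τ⁻¹ • X t ω)) →
          uniformExpect μ T (fun t ω => ‖gradient f (Preal t ω)‖ ^ 2) ≤
            C * (σ * Real.sqrt ((f P0 - f Pstar) / (T / L)) + L ^ 2 * (s ^ 2 + r ^ (2 * k)))) ∧
        -- the individual `s` and `r` of each logit matrix
        (∀ r : ℕ → Ω → ℝ,
          (∀ t ≤ T, AEStronglyMeasurable (r t) μ) →
          (∀ t ≤ T, ∀ᵐ ω ∂μ, IsSinkhornRate A (r t ω) (τ⁻¹ • X t ω)) →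
          uniformExpect μ T (fun t ω => ‖gradient f (Preal t ω)‖ ^ 2) ≤
            C * (σ * Real.sqrt ((f P0 - f Pstar) / (T / L)) +
              L ^ 2 * uniformExpect μ T
                (fun t ω => tempError τ (X t ω) ^ 2 + r t ω ^ (2 * k)))))
 := by 
  refine ⟨⟨2 * N + 2, by positivity, fun K hK => exists_tempError_bound_and_rate hK⟩,
    fun A _ => ⟨3 + 2 * A ^ 2, by positivity, ?_⟩⟩
  intro Ω mΩ μ _ ℱ f L σ τ k T P0 Pstar X PGS Preal g hL hσ _ hk hT hf h hstar hgrad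
  have hmain := h.uniformExpect_gradient_le hL hσ hk hT hf hstar hgrad
  have hx : 0 ≤ σ * Real.sqrt ((f P0 - f Pstar) / (T / L)) := by positivity
  have hy : 0 ≤ uniformExpect μ T (fun t ω => ‖PGS t ω - Preal t ω‖ ^ 2) :=
    uniformExpect_nonneg fun _ _ => sq_nonneg _
  exact ⟨fun s r hsr => le_mul_add_of_le hx (h.uniformExpect_sub_le_const hk hsr) hy hmain,
    fun r hmeas hr => le_mul_add_of_le hx (h.uniformExpect_sub_le hk hmeas hr) hy hmain⟩
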